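/- Let $a_1,a_2,h_1,h_2:\mathbb R\to\mathbb R$ be continuous. Assume that there are constants $0<c\le C$ with $c\le a_i(t)\le C$ for all $t\in\mathbb R$ and $i=1,2$, and that $h_1,h_2$ are bounded on $\mathbb R$. Let $f,g:\mathbb R^2\to\mathbb R$ be continuous functions of $(x,y)$ whose first partial derivatives $f_x,f_y,g_x,g_y$ exist at every point of $\mathbb R^2$. Assume that 1. $f(x,y)\to\infty$ as $x\to\infty$ and $f(x,y)\to-\infty$ as $x\to-\infty$, uniformly in $y\in\mathbb R$; 2. $g(x,y)\to\infty$ as $y\to\infty$ and $g(x,y)\to-\infty$ as $y\to-\infty$, uniformly in $x\in\mathbb R$; 3. there is $\alpha\in\mathbb R$ such that $x f(x,y)\ge\alpha$ and $y g(x,y)\ge\alpha$ for all $(x,y)\in\mathbb R^2$; 4. for all $t,x,y\in\mathbb R$ the quadratic form in $(w,z)$ $$a_1(t)f_x(x,y)\,w^2+\bigl(a_1(t)f_y(x,y)+a_2(t)g_x(x,y)\bigr)wz+a_2(t)g_y(x,y)\,z^2$$ is positive semi-definite, i.e. nonnegative for all $w,z\in\mathbb R$. Then the system $$u''-a_1(t)f(u,v)=h_1(t),\qquad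 v''-a_2(t)g(u,v)=h_2(t)$$ has a classical solution that is bounded on the whole line: there are $u,v\in C^2(\mathbb R)$ satisfying both equations at every $t\in\mathbb R$, and a constant $K$ with $|u(t)|\le K$ and $|v(t)|\le K$ for all $t\in\mathbb R$. -/

import Mathlib

open Filter Topology

/-! For large `M` the coercivity of `f` and `g`, uniform in the other variable, makes both forces
`a₁ f + h₁` and `a₂ g + h₂` push outwards beyond `±M`. Clipping the arguments of `f` and `g` to
`[-M, M]` keeps these signs and makes the forces bounded. A maximum principle then confines
solutions to the square, where clipping changes nothing.

The clipped system is solved with zero boundary values on `[-n, n]`, discretized with step `1 / n`.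
The recursion is explicit and continuous in the two initial slopes, and a large slope decides the
sign of the endpoint, so shooting succeeds by Poincaré–Miranda (`exists_common_zero`). The maximum
principle bounds the values by `M`, hence the slopes, independently of `n`.

Limits along one fixed ultrafilter refine the mesh and exhaust the line at once. Since `hyperfilter
ℕ` serves every `t`, the limits of values and slopes are compatible, and `hasDerivAt_mesh_limit`
turns the recursions into the differential equations. -/

/-! ### A planar Poincaré–Miranda theorem -/

/-- A continuous angle whose cosine relative to `c` stays positive cannot leave the half circle
centred at `c`. -/
theorem abs_sub_lt_pi_div_two_of_cos_pos {θ : ℝ → ℝ} (hθ : Continuous θ) {c a : ℝ}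
    (hcos : ∀ s, 0 < Real.cos (θ s - c)) (ha : |θ a - c| < Real.pi / 2) (b : ℝ) :
    |θ b - c| < Real.pi / 2 := by
  by_contra! hb
  obtain ⟨s, hs⟩ : ∃ s, |θ s - c| = Real.pi / 2 :=
    mem_range_of_exists_le_of_exists_ge (f := fun s => |θ s - c|) (by fun_prop)
      ⟨a, ha.le⟩ ⟨b, hb⟩
  have h := hcos s
  rw [← Real.cos_abs, hs, Real.cos_pi_div_two] at h
  exact h.false

/-- Corner of the square: the angle lies in the half circles of both adjacent sides, and this fixes
its branch modulo `2π` for the next side. -/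
theorem abs_sub_sub_pi_div_two_lt {θ c c' : ℝ} (hc' : c' = c + Real.pi / 2)
    (h : |θ - c| < Real.pi / 2) (hcos : 0 < Real.cos (θ - c')) : |θ - c'| < Real.pi / 2 := by
  have hx := abs_lt.1 h
  have hsin : 0 < Real.sin (θ - c) := by
    rwa [← Real.cos_sub_pi_div_two, sub_sub, ← hc']
  have h0 : 0 < θ - c := by
    by_contra! h0
    exact (Real.sin_nonpos_of_nonpos_of_neg_pi_le h0 (by linarith [Real.pi_pos])).not_gt hsin
  rw [abs_lt]
  constructor <;> linarith

/-- Poincaré–Miranda in the plane: if `φ` has the sign of `p` for `|p| ≥ P` and `ψ` has the sign of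
`q` for `|q| ≥ P`, then `φ` and `ψ` have a common zero. -/
theorem exists_common_zero {φ ψ : ℝ × ℝ → ℝ} (hφ : Continuous φ) (hψ : Continuous ψ) {P : ℝ}
    (hφ_pos : ∀ q, 0 < φ (P, q)) (hφ_neg : ∀ q, φ (-P, q) < 0)
    (hψ_pos : ∀ p, 0 < ψ (p, P)) (hψ_neg : ∀ p, ψ (p, -P) < 0) :
    ∃ z, φ z = 0 ∧ ψ z = 0 := by
  by_contra! hne
  let G : C(ℝ × ℝ, ℂ) := ⟨fun z => ⟨φ z, ψ z⟩, by
    have : (fun z => (⟨φ z, ψ z⟩ : ℂ)) = fun z => (φ z : ℂ) + ψ z * Complex.I := by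
      ext z; exact Complex.mk_eq_add_mul_I _ _
    rw [this]; fun_prop⟩
  have hG : ∀ z, G z ≠ 0 := fun z hz =>
    hne z (congrArg Complex.re hz) (congrArg Complex.im hz)
  -- A nowhere zero map on the simply connected plane has a continuous logarithm; its imaginary part
  -- is a continuous angle.
  obtain ⟨Λ, ⟨hΛ0, hΛ⟩, -⟩ := Complex.isCoveringMapOn_exp.existsUnique_continuousMap_lifts G
    (a₀ := (P, -P)) (Complex.exp_log (hG _)) hG
  have hexp : ∀ z, Complex.exp (Λ z) = G z := fun z => congrFun hΛ z
  have hre : ∀ z, Real.exp (Λ z).re * Real.cos (Λ z).im = φ z := fun z => by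
    rw [← Complex.exp_re, hexp]; rfl
  have him : ∀ z, Real.exp (Λ z).re * Real.sin (Λ z).im = ψ z := fun z => by
    rw [← Complex.exp_im, hexp]; rfl
  have hright : ∀ q, 0 < Real.cos ((Λ (P, q)).im - 0) := fun q => by
    rw [sub_zero]
    exact pos_of_mul_pos_right ((hre (P, q)).symm ▸ hφ_pos q) (Real.exp_pos _).le
  have htop : ∀ p, 0 < Real.cos ((Λ (p, P)).im - Real.pi / 2) := fun p => by
    rw [Real.cos_sub_pi_div_two]
    exact pos_of_mul_pos_right ((him (p, P)).symm ▸ hψ_pos p) (Real.exp_pos _).le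
  have hleft : ∀ q, 0 < Real.cos ((Λ (-P, q)).im - Real.pi) := fun q => by
    rw [Real.cos_sub_pi]
    have h := hre (-P, q)
    have := hφ_neg q
    exact pos_of_mul_pos_right (a := Real.exp (Λ (-P, q)).re) (by linarith) (Real.exp_pos _).le
  have hbot : ∀ p, 0 < Real.cos ((Λ (p, -P)).im - (Real.pi + Real.pi / 2)) := fun p => by
    rw [← sub_sub, Real.cos_sub_pi_div_two, Real.sin_sub_pi]
    have h := him (p, -P)
    have := hψ_neg p
    exact pos_of_mul_pos_right (a := Real.exp (Λ (p, -P)).re) (by linarith) (Real.exp_pos _).le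
  have h0 : |(Λ (P, -P)).im - 0| < Real.pi / 2 := by
    rw [hΛ0, Complex.log_im, sub_zero, Complex.abs_arg_lt_pi_div_two_iff]
    exact Or.inl (hφ_pos _)
  have h1 := abs_sub_lt_pi_div_two_of_cos_pos (θ := fun q => (Λ (P, q)).im) (by fun_prop)
    hright h0 P
  have h2 := abs_sub_lt_pi_div_two_of_cos_pos (θ := fun p => (Λ (p, P)).im) (by fun_prop)
    htop (abs_sub_sub_pi_div_two_lt (by ring) h1 (htop P)) (-P)
  have h3 := abs_sub_lt_pi_div_two_of_cos_pos (θ := fun q => (Λ (-P, q)).im) (by fun_prop)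
    hleft (abs_sub_sub_pi_div_two_lt (by ring) h2 (hleft P)) (-P)
  have h4 := abs_sub_lt_pi_div_two_of_cos_pos (θ := fun p => (Λ (p, -P)).im) (by fun_prop)
    hbot (abs_sub_sub_pi_div_two_lt rfl h3 (hbot (-P))) P
  -- After one circuit of the square the angle at `(P, -P)` exceeds `π`, yet it started below `π /
  -- 2`.
  rw [abs_lt] at h0 h4
  linarith [h0.2, h4.1, Real.pi_pos]

/-! ### Discrete boundary value problems -/

/-- Increments of a sequence of Euler steps whose slopes are within `ε` of `γ`. -/
theorem abs_euler_sub_le {Z c : ℕ → ℝ} {δ γ ε : ℝ} (hδ : 0 ≤ δ)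
    (hZ : ∀ k, Z (k + 1) = Z k + δ * c k) (i j : ℕ) (hc : ∀ m < j, |c (i + m) - γ| ≤ ε) :
    |Z (i + j) - Z i - j * δ * γ| ≤ j * δ * ε := by
  induction j with
  | zero => simp
  | succ j ih =>
    have h1 := ih fun m hm => hc m (by omega)
    have h2 : |δ * (c (i + j) - γ)| ≤ δ * ε := by
      rw [abs_mul, abs_of_nonneg hδ]
      exact mul_le_mul_of_nonneg_left (hc j (by omega)) hδ
    rw [← add_assoc, hZ]
    push_cast
    rw [show Z (i + j) + δ * c (i + j) - Z i - (j + 1) * δ * γ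
      = (Z (i + j) - Z i - j * δ * γ) + δ * (c (i + j) - γ) by ring]
    exact (abs_add_le _ _).trans (by linarith)

/-- Explicit recursion for the discretized system `x'' = F`, `y'' = G` started at the origin with
slopes `p`, `q`; the state is `((x, y), (w, e))` with `w`, `e` the slopes. -/
def shoot (F G : ℕ → ℝ → ℝ → ℝ) (δ : ℝ) (z : ℝ × ℝ) : ℕ → (ℝ × ℝ) × (ℝ × ℝ)
  | 0 => ((0, 0), z)
  | k + 1 =>
    let s := shoot F G δ z k
    ((s.1.1 + δ * s.2.1, s.1.2 + δ * s.2.2),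
      -- The force is taken at the new position, so it gives the second difference centred at index
      -- `k + 1`, as the maximum principle needs.
      (s.2.1 + δ * F (k + 1) (s.1.1 + δ * s.2.1) (s.1.2 + δ * s.2.2),
        s.2.2 + δ * G (k + 1) (s.1.1 + δ * s.2.1) (s.1.2 + δ * s.2.2)))

theorem continuous_shoot {F G : ℕ → ℝ → ℝ → ℝ}
    (hF : ∀ k, Continuous fun z : ℝ × ℝ => F k z.1 z.2)
    (hG : ∀ k, Continuous fun z : ℝ × ℝ => G k z.1 z.2) (δ : ℝ) (k : ℕ) :
    Continuous fun z => shoot F G δ z k := by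
  induction k with
  | zero => simp only [shoot]; fun_prop
  | succ k ih =>
    have hpos : Continuous fun z => ((shoot F G δ z k).1.1 + δ * (shoot F G δ z k).2.1,
        (shoot F G δ z k).1.2 + δ * (shoot F G δ z k).2.2) := by fun_prop
    have h1 := (hF (k + 1)).comp hpos
    have h2 := (hG (k + 1)).comp hpos
    simp only [Function.comp_def] at h1 h2
    simp only [shoot]
    fun_prop

/-- The endpoint of a trajectory with bounded second differences is governed by a large slope. -/
theorem abs_euler_end_sub_le {x w c : ℕ → ℝ} {δ B : ℝ} (hδ : 0 ≤ δ) (hB : 0 ≤ B) (hx0 : x 0 = 0)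
    (hx : ∀ k, x (k + 1) = x k + δ * w k) (hw : ∀ k, w (k + 1) = w k + δ * c k)
    (hc : ∀ k, |c k| ≤ B) (N : ℕ) : |x N - N * δ * w 0| ≤ N * δ * (N * δ * B) := by
  have h := abs_euler_sub_le hδ hx 0 N (γ := w 0) (ε := N * δ * B) fun m hm => by
    have h := abs_euler_sub_le hδ hw 0 m (γ := 0) (ε := B) fun i _ => by simpa using hc _
    rw [mul_zero, sub_zero, zero_add] at h
    rw [zero_add]
    refine h.trans ?_
    gcongr
  simpa [hx0] using h

/-- Solvability of the discrete Dirichlet problem with bounded continuous right-hand sides. -/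
theorem exists_discrete_dirichlet {F G : ℕ → ℝ → ℝ → ℝ}
    (hF : ∀ k, Continuous fun z : ℝ × ℝ => F k z.1 z.2)
    (hG : ∀ k, Continuous fun z : ℝ × ℝ => G k z.1 z.2) {B δ : ℝ} (hδ : 0 < δ)
    (hFB : ∀ k x y, |F k x y| ≤ B) (hGB : ∀ k x y, |G k x y| ≤ B) {N : ℕ} (hN : 0 < N) :
    ∃ x y w e : ℕ → ℝ, x 0 = 0 ∧ y 0 = 0 ∧ x N = 0 ∧ y N = 0 ∧
      (∀ k, x (k + 1) = x k + δ * w k) ∧ (∀ k, y (k + 1) = y k + δ * e k) ∧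
      (∀ k, w (k + 1) = w k + δ * F (k + 1) (x (k + 1)) (y (k + 1))) ∧
      (∀ k, e (k + 1) = e k + δ * G (k + 1) (x (k + 1)) (y (k + 1))) := by
  have hB : 0 ≤ B := (abs_nonneg _).trans (hFB 0 0 0)
  have hNδ : 0 < N * δ := by positivity
  have hcont := continuous_shoot hF hG δ N
  have hx := fun z => abs_euler_end_sub_le (x := fun k => (shoot F G δ z k).1.1)
    (w := fun k => (shoot F G δ z k).2.1) hδ.le hB rfl (fun _ => rfl) (fun _ => rfl)
    (fun _ => hFB _ _ _) N
  have hy := fun z => abs_euler_end_sub_le (x := fun k => (shoot F G δ z k).1.2)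
    (w := fun k => (shoot F G δ z k).2.2) hδ.le hB rfl (fun _ => rfl) (fun _ => rfl)
    (fun _ => hGB _ _ _) N
  simp only [shoot, abs_le] at hx hy
  -- The endpoint differs from `N * δ * p` by at most `N * δ * (N * δ * B)`, so the slopes `±(N * δ
  -- * B + 1)` fix its sign.
  obtain ⟨z, hz1, hz2⟩ := exists_common_zero (φ := fun z => (shoot F G δ z N).1.1)
    (ψ := fun z => (shoot F G δ z N).1.2) (P := N * δ * B + 1) (by fun_prop) (by fun_prop)
    (fun q => by have := (hx (N * δ * B + 1, q)).1; dsimp only at this; nlinarith)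
    (fun q => by have := (hx (-(N * δ * B + 1), q)).2; dsimp only at this; nlinarith)
    (fun p => by have := (hy (p, N * δ * B + 1)).1; dsimp only at this; nlinarith)
    (fun p => by have := (hy (p, -(N * δ * B + 1))).2; dsimp only at this; nlinarith)
  exact ⟨fun k => (shoot F G δ z k).1.1, fun k => (shoot F G δ z k).1.2,
    fun k => (shoot F G δ z k).2.1, fun k => (shoot F G δ z k).2.2, rfl, rfl, hz1, hz2,
    fun _ => rfl, fun _ => rfl, fun _ => rfl, fun _ => rfl⟩

/-- Discrete maximum principle. -/
theorem discrete_le_of_convex_above {x w c : ℕ → ℝ} {δ M : ℝ} (hδ : 0 < δ)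
    (hx : ∀ k, x (k + 1) = x k + δ * w k) (hw : ∀ k, w (k + 1) = w k + δ * c k) {N : ℕ}
    (hx0 : x 0 ≤ M) (hxN : x N ≤ M) (hc : ∀ k, M < x (k + 1) → 0 < c k) :
    ∀ k ≤ N, x k ≤ M := by
  obtain ⟨m, hm, hmax⟩ := (Finset.range (N + 1)).exists_max_image x ⟨0, by simp⟩
  simp only [Finset.mem_range, Nat.lt_succ_iff] at hm hmax
  suffices h : x m ≤ M from fun k hk => (hmax k hk).trans h
  by_contra! h
  have hmN : m ≠ N := by rintro rfl; exact h.not_ge hxN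
  obtain _ | i := m
  · exact h.not_ge hx0
  have h1 := hmax (i + 1 + 1) (by omega)
  have h2 := hmax i (by omega)
  -- At an interior maximum above `M` the second difference `δ * (δ * c i)` would be both positive
  -- and nonpositive.
  have h3 := mul_pos hδ (mul_pos hδ (hc i h))
  have h4 : δ * w (i + 1) = δ * w i + δ * (δ * c i) := by rw [hw]; ring
  linarith [hx i, hx (i + 1)]

theorem discrete_abs_le {x w c : ℕ → ℝ} {δ M : ℝ} (hδ : 0 < δ) (hM : 0 ≤ M)
    (hx : ∀ k, x (k + 1) = x k + δ * w k) (hw : ∀ k, w (k + 1) = w k + δ * c k) {N : ℕ}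
    (hx0 : x 0 = 0) (hxN : x N = 0) (hc : ∀ k, M < x (k + 1) → 0 < c k)
    (hc' : ∀ k, x (k + 1) < -M → c k < 0) {k : ℕ} (hk : k ≤ N) : |x k| ≤ M := by
  rw [abs_le]
  constructor
  · have := discrete_le_of_convex_above (x := fun k => -x k) (w := fun k => -w k)
      (c := fun k => -c k) (M := M) hδ (fun k => by rw [hx]; ring) (fun k => by rw [hw]; ring)
      (N := N) (by simpa [hx0]) (by simpa [hxN])
      (fun k h => by have := hc' k (by linarith); linarith) k hk
    linarith
  · exact discrete_le_of_convex_above hδ hx hw (by linarith) (by linarith) hc k hk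

/-- Bound on the slopes from a bound on the values and on the second differences. -/
theorem discrete_slope_abs_le {x w c : ℕ → ℝ} {n N : ℕ} (hn : 0 < n) {M B : ℝ} (hB : 0 ≤ B)
    (hx : ∀ k, x (k + 1) = x k + 1 / n * w k) (hw : ∀ k, w (k + 1) = w k + 1 / n * c k)
    (hM : ∀ k ≤ N, |x k| ≤ M) (hc : ∀ k, |c k| ≤ B) {k : ℕ} (hk : k + n ≤ N) :
    |w k| ≤ 2 * M + B := by
  have hδ : (0 : ℝ) ≤ 1 / n := by positivity
  have hn' : (n : ℝ) * (1 / n) = 1 := by field_simp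
  -- Over `n` steps, that is unit time, the slope drifts by at most `B`, so `w k` is within `B` of a
  -- difference of two values bounded by `M`.
  have h := abs_euler_sub_le hδ hx k n (γ := w k) (ε := B) fun m hm => by
    have h := abs_euler_sub_le hδ hw k m (γ := 0) (ε := B) fun i _ => by simpa using hc _
    rw [mul_zero, sub_zero] at h
    have hmn : (m : ℝ) * (1 / n) ≤ 1 := by
      calc (m : ℝ) * (1 / n) ≤ n * (1 / n) := by gcongr
        _ = 1 := hn'
    exact h.trans (mul_le_of_le_one_left hB hmn)
  rw [hn', one_mul, one_mul, abs_le] at h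
  have h1 := abs_le.1 (hM k (by omega))
  have h2 := abs_le.1 (hM (k + n) hk)
  rw [abs_le]
  constructor <;> linarith

/-! ### Limits of Euler sequences on refining meshes -/

/-- The `k`-th node of the mesh of width `1 / n` starting at `-n`, for `p = (n, k)`. -/
noncomputable def meshNode (p : ℕ × ℕ) : ℝ := p.2 / p.1 - p.1

/-- The index of the last node of the `n`-th mesh which does not exceed `t`. -/
noncomputable def meshIndex (n : ℕ) (t : ℝ) : ℕ := ⌊n * (t + n)⌋₊

/-- Pairs `(n, k)` with `n` along `l` and with the node of `(n, k)` tending to `t`. -/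
noncomputable def meshFilter (l : Filter ℕ) (t : ℝ) : Filter (ℕ × ℕ) :=
  comap Prod.fst l ⊓ comap meshNode (𝓝 t)

theorem meshNode_meshIndex_le {n : ℕ} (hn : 0 < n) {t : ℝ} (ht : -n ≤ t) :
    meshNode (n, meshIndex n t) ≤ t := by
  have hn' : (0 : ℝ) < n := by exact_mod_cast hn
  have h := Nat.floor_le (mul_nonneg hn'.le (by linarith : 0 ≤ t + n))
  rw [meshNode, sub_le_iff_le_add, div_le_iff₀ hn', mul_comm]
  exact h

theorem lt_meshNode_meshIndex_add {n : ℕ} (hn : 0 < n) (t : ℝ) :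
    t < meshNode (n, meshIndex n t) + 1 / n := by
  have hn' : (0 : ℝ) < n := by exact_mod_cast hn
  have h := Nat.lt_floor_add_one (n * (t + n) : ℝ)
  have h2 : t + n < (meshIndex n t + 1) / n := by
    rw [lt_div_iff₀ hn', mul_comm]
    exact h
  rw [add_div] at h2
  simp only [meshNode]
  linarith

theorem meshNode_mono {n j k : ℕ} (h : j ≤ k) : meshNode (n, j) ≤ meshNode (n, k) := by
  simp only [meshNode]; gcongr

theorem meshNode_sub_meshNode (n i j : ℕ) :
    meshNode (n, i + j) - meshNode (n, i) = j * (1 / n : ℝ) := by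
  simp only [meshNode]; push_cast; ring

theorem tendsto_one_div_hyperfilter :
    Tendsto (fun n : ℕ => 1 / (n : ℝ)) (hyperfilter ℕ : Filter ℕ) (𝓝 0) :=
  tendsto_one_div_atTop_nhds_zero_nat.mono_left Nat.hyperfilter_le_atTop

theorem tendsto_fst_meshFilter (l : Filter ℕ) (t : ℝ) : Tendsto Prod.fst (meshFilter l t) l :=
  tendsto_comap.mono_left inf_le_left

theorem tendsto_meshNode (l : Filter ℕ) (t : ℝ) : Tendsto meshNode (meshFilter l t) (𝓝 t) :=
  tendsto_comap.mono_left inf_le_right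

theorem tendsto_meshFilter_iff {α : Type*} {m : Filter α} {l : Filter ℕ} {t : ℝ}
    {f : α → ℕ × ℕ} : Tendsto f m (meshFilter l t) ↔
      Tendsto (fun a => (f a).1) m l ∧ Tendsto (fun a => meshNode (f a)) m (𝓝 t) := by
  simp only [meshFilter, tendsto_inf, tendsto_comap_iff, Function.comp_def]

/-- Extracts a radius `η` that does not depend on `n`. -/
theorem eventually_meshFilter {l : Filter ℕ} {t : ℝ} {P : ℕ × ℕ → Prop}
    (h : ∀ᶠ p in meshFilter l t, P p) :
    ∃ η > 0, ∀ᶠ n in l, ∀ k, |meshNode (n, k) - t| < η → P (n, k) := by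
  obtain ⟨⟨s, η⟩, ⟨hs, hη⟩, hsub⟩ :=
    ((l.basis_sets.comap Prod.fst).inf (Metric.nhds_basis_ball.comap meshNode)).mem_iff.1 h
  refine ⟨η, hη, ?_⟩
  filter_upwards [hs] with n hn k hk
  exact hsub ⟨hn, hk⟩

theorem eventually_hyperfilter_ge (a : ℝ) : ∀ᶠ n : ℕ in (hyperfilter ℕ : Filter ℕ), a ≤ n :=
  (tendsto_natCast_atTop_atTop.eventually_ge_atTop a).filter_mono Nat.hyperfilter_le_atTop

theorem eventually_hyperfilter_pos : ∀ᶠ n in (hyperfilter ℕ : Filter ℕ), 0 < n :=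
  (eventually_gt_atTop 0).filter_mono Nat.hyperfilter_le_atTop

theorem tendsto_meshIndex (t : ℝ) : Tendsto (fun n => (n, meshIndex n t))
    (hyperfilter ℕ : Filter ℕ) (meshFilter (hyperfilter ℕ) t) := by
  refine tendsto_meshFilter_iff.2 ⟨tendsto_id, ?_⟩
  have h1 : Tendsto (fun n : ℕ => t - 1 / (n : ℝ)) (hyperfilter ℕ : Filter ℕ) (𝓝 t) := by
    simpa using tendsto_one_div_hyperfilter.const_sub t
  refine tendsto_of_tendsto_of_tendsto_of_le_of_le' h1 tendsto_const_nhds ?_ ?_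
  · filter_upwards [eventually_hyperfilter_pos] with n hn
    linarith [lt_meshNode_meshIndex_add hn t]
  · filter_upwards [eventually_hyperfilter_pos, eventually_hyperfilter_ge (-t)] with n hn hnt
    exact meshNode_meshIndex_le hn (by linarith)

/-- Needed because the slope recursion evaluates the force at index `k + 1`. -/
theorem tendsto_succ_meshFilter (t : ℝ) : Tendsto (fun p : ℕ × ℕ => (p.1, p.2 + 1))
    (meshFilter (hyperfilter ℕ) t) (meshFilter (hyperfilter ℕ) t) := by
  refine tendsto_meshFilter_iff.2 ⟨tendsto_fst_meshFilter _ t, ?_⟩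
  have h := (tendsto_meshNode (hyperfilter ℕ) t).add
    (tendsto_one_div_hyperfilter.comp (tendsto_fst_meshFilter _ t))
  rw [add_zero] at h
  refine h.congr fun p => ?_
  have := meshNode_sub_meshNode p.1 p.2 1
  simp only [Function.comp_apply, Nat.cast_one, one_mul] at this ⊢
  linarith

/-- A family bounded near every point has pointwise limits along the hyperfilter. -/
theorem exists_mesh_limit {Z : ℕ → ℕ → ℝ} {D : ℝ}
    (hZ : ∀ t, ∀ᶠ p in meshFilter (hyperfilter ℕ) t, |Z p.1 p.2| ≤ D) :
    ∃ z : ℝ → ℝ, (∀ t, |z t| ≤ D) ∧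
      ∀ t, Tendsto (fun n => Z n (meshIndex n t)) (hyperfilter ℕ : Filter ℕ) (𝓝 (z t)) := by
  have h : ∀ t, ∃ a, |a| ≤ D ∧
      Tendsto (fun n => Z n (meshIndex n t)) (hyperfilter ℕ : Filter ℕ) (𝓝 a) := fun t => by
    -- An ultrafilter on a compact interval converges, so no subsequence has to be chosen.
    obtain ⟨a, ha, hlim⟩ := isCompact_iff_ultrafilter_le_nhds.1
      (isCompact_Icc (a := -D) (b := D))
      ((hyperfilter ℕ).map fun n => Z n (meshIndex n t)) (by
        rw [le_principal_iff]
        exact ((tendsto_meshIndex t).eventually (hZ t)).mono fun n hn => abs_le.1 hn)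
    exact ⟨a, abs_le.2 ha, hlim⟩
  choose z hz using h
  exact ⟨z, fun t => (hz t).1, fun t => (hz t).2⟩

/-- Euler sequences with locally bounded slopes converge jointly in the mesh width and the node. -/
theorem tendsto_mesh_of_slope_bounded {Z c : ℕ → ℕ → ℝ} {t a D : ℝ}
    (hZ : ∀ n, 0 < n → ∀ k, Z n (k + 1) = Z n k + 1 / n * c n k)
    (hc : ∀ᶠ p in meshFilter (hyperfilter ℕ) t, |c p.1 p.2| ≤ D)
    (ha : Tendsto (fun n => Z n (meshIndex n t)) (hyperfilter ℕ : Filter ℕ) (𝓝 a)) :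
    Tendsto (fun p : ℕ × ℕ => Z p.1 p.2) (meshFilter (hyperfilter ℕ) t) (𝓝 a) := by
  have hfst := tendsto_fst_meshFilter (hyperfilter ℕ) t
  have hnode := tendsto_meshNode (hyperfilter ℕ) t
  obtain ⟨η, hη, hcη⟩ := eventually_meshFilter hc
  have hbound : Tendsto (fun p : ℕ × ℕ => (|meshNode p - t| + 1 / (p.1 : ℝ)) * |D|)
      (meshFilter (hyperfilter ℕ) t) (𝓝 0) := by
    simpa using (((hnode.sub_const t).abs.add
      (tendsto_one_div_hyperfilter.comp hfst)).mul_const |D|)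
  have hdiff : Tendsto (fun p : ℕ × ℕ => Z p.1 p.2 - Z p.1 (meshIndex p.1 t))
      (meshFilter (hyperfilter ℕ) t) (𝓝 0) := by
    refine squeeze_zero_norm' ?_ hbound
    filter_upwards [hfst.eventually hcη, hfst.eventually eventually_hyperfilter_pos,
      hfst.eventually (eventually_hyperfilter_ge (-t)),
      hfst.eventually (tendsto_one_div_hyperfilter.eventually_lt_const hη),
      hnode.eventually (Metric.ball_mem_nhds t hη)] with p hp hn hnt hnη hpη
    obtain ⟨n, k⟩ := p
    dsimp only at hp hn hnt hnη hpη ⊢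
    rw [Real.dist_eq] at hpη
    have hδ : (0 : ℝ) ≤ 1 / n := by positivity
    have h1 := meshNode_meshIndex_le hn (by linarith : -(n : ℝ) ≤ t)
    have h2 := lt_meshNode_meshIndex_add hn t
    have h3 := abs_lt.1 hpη
    have hslope : ∀ m, |meshNode (n, m) - t| < η → |c n m - 0| ≤ |D| := fun m hm => by
      rw [sub_zero]; exact (hp m hm).trans (le_abs_self D)
    rw [Real.norm_eq_abs]
    obtain hk | hk := le_total (meshIndex n t) k
    · obtain ⟨j, rfl⟩ := Nat.exists_eq_add_of_le hk
      have h := abs_euler_sub_le hδ (hZ n hn) (meshIndex n t) j (γ := 0) (ε := |D|)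
        fun m hm => hslope _ (by
          have := meshNode_mono (n := n) (Nat.le_add_right (meshIndex n t) m)
          have := meshNode_mono (n := n) (Nat.add_le_add_left hm.le (meshIndex n t))
          rw [abs_lt]; constructor <;> linarith)
      rw [mul_zero, sub_zero] at h
      refine h.trans (mul_le_mul_of_nonneg_right ?_ (abs_nonneg _))
      rw [← meshNode_sub_meshNode n (meshIndex n t) j]
      linarith [le_abs_self (meshNode (n, meshIndex n t + j) - t)]
    · obtain ⟨j, hj⟩ := Nat.exists_eq_add_of_le hk
      have h := abs_euler_sub_le hδ (hZ n hn) k j (γ := 0) (ε := |D|)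
        fun m hm => hslope _ (by
          have := meshNode_mono (n := n) (Nat.le_add_right k m)
          have := meshNode_mono (n := n) (Nat.add_le_add_left hm.le k)
          rw [← hj] at this
          rw [abs_lt]; constructor <;> linarith)
      rw [mul_zero, sub_zero, ← hj, abs_sub_comm] at h
      refine h.trans (mul_le_mul_of_nonneg_right ?_ (abs_nonneg _))
      rw [← meshNode_sub_meshNode n k j, ← hj]
      linarith [neg_abs_le (meshNode (n, k) - t)]
  have h := hdiff.add (ha.comp hfst)
  rw [zero_add] at h
  exact h.congr fun p => by simp

/-- Rounding `s` and `r` down to nodes changes the elapsed time by at most `1 / n`, whence the last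
error term. -/
theorem abs_mesh_increment_sub_le {Z c : ℕ → ℝ} {n : ℕ} (hn : 0 < n) {s r γ ε : ℝ}
    (hs : -n ≤ s) (hsr : s ≤ r) (hε : 0 ≤ ε) (hZ : ∀ k, Z (k + 1) = Z k + 1 / n * c k)
    (hc : ∀ k, s - 1 / n < meshNode (n, k) → meshNode (n, k) ≤ r → |c k - γ| ≤ ε) :
    |Z (meshIndex n r) - Z (meshIndex n s) - (r - s) * γ|
      ≤ (r - s) * ε + 1 / n * (ε + |γ|) := by
  have h1 := meshNode_meshIndex_le hn hs
  have h2 := lt_meshNode_meshIndex_add hn s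
  have h3 := meshNode_meshIndex_le hn (hs.trans hsr)
  have h4 := lt_meshNode_meshIndex_add hn r
  obtain ⟨j, hj⟩ : ∃ j, meshIndex n r = meshIndex n s + j :=
    Nat.exists_eq_add_of_le (Nat.floor_le_floor (by gcongr))
  have h := abs_euler_sub_le (by positivity) hZ (meshIndex n s) j (γ := γ) (ε := ε) fun m hm => by
    have h5 := meshNode_mono (n := n) (Nat.le_add_right (meshIndex n s) m)
    have h6 := meshNode_mono (n := n) (Nat.add_le_add_left hm.le (meshIndex n s))
    rw [← hj] at h6
    exact hc _ (by linarith) (by linarith)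
  rw [← meshNode_sub_meshNode n (meshIndex n s) j, ← hj] at h
  set τ := meshNode (n, meshIndex n r) - meshNode (n, meshIndex n s)
  have hτ : |τ - (r - s)| ≤ 1 / n := by rw [abs_le]; constructor <;> linarith
  have hτ' : τ ≤ r - s + 1 / n := by linarith
  calc _ = |(Z (meshIndex n r) - Z (meshIndex n s) - τ * γ) + (τ - (r - s)) * γ| := by ring_nf
    _ ≤ τ * ε + |τ - (r - s)| * |γ| := by
      rw [← abs_mul]; exact (abs_add_le _ _).trans (by gcongr)
    _ ≤ (r - s + 1 / n) * ε + 1 / n * |γ| := by gcongr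
    _ = _ := by ring

/-- If the slopes of Euler sequences converge at `t`, their limit is differentiable at `t`. -/
theorem hasDerivAt_mesh_limit {Z c : ℕ → ℕ → ℝ} {z : ℝ → ℝ} {t γ : ℝ}
    (hZ : ∀ n, 0 < n → ∀ k, Z n (k + 1) = Z n k + 1 / n * c n k)
    (hc : Tendsto (fun p : ℕ × ℕ => c p.1 p.2) (meshFilter (hyperfilter ℕ) t) (𝓝 γ))
    (hz : ∀ s, Tendsto (fun n => Z n (meshIndex n s)) (hyperfilter ℕ : Filter ℕ) (𝓝 (z s))) :
    HasDerivAt z γ t := by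
  rw [hasDerivAt_iff_isLittleO, Asymptotics.isLittleO_iff]
  intro ε hε
  obtain ⟨η, hη, hcη⟩ := eventually_meshFilter (hc.eventually (Metric.ball_mem_nhds γ hε))
  -- The estimate is made for ordered pairs near `t`, so that `t` can serve as either endpoint.
  have key : ∀ s r, s ≤ r → t - η / 2 < s → r < t + η / 2 →
      |z r - z s - (r - s) * γ| ≤ (r - s) * ε := fun s r hsr hs hr => by
    have hlim : Tendsto (fun n : ℕ => (r - s) * ε + 1 / (n : ℝ) * (ε + |γ|))
        (hyperfilter ℕ : Filter ℕ) (𝓝 ((r - s) * ε)) := by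
      simpa using (tendsto_one_div_hyperfilter.mul_const (ε + |γ|)).const_add ((r - s) * ε)
    refine le_of_tendsto_of_tendsto (((hz r).sub (hz s)).sub_const _).abs hlim ?_
    filter_upwards [hcη, eventually_hyperfilter_pos, eventually_hyperfilter_ge (-s),
      tendsto_one_div_hyperfilter.eventually_lt_const (half_pos hη)] with n hcn hn hns hnη
    refine abs_mesh_increment_sub_le hn (by linarith) hsr hε.le (hZ n hn) fun k hk1 hk2 => ?_
    have := hcn k (by rw [abs_lt]; constructor <;> linarith)
    rw [Real.dist_eq] at this
    exact this.le
  filter_upwards [Metric.ball_mem_nhds t (half_pos hη)] with s hs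
  rw [Metric.mem_ball, Real.dist_eq, abs_lt] at hs
  simp only [Real.norm_eq_abs, smul_eq_mul]
  obtain h | h := le_total t s
  · rw [abs_of_nonneg (sub_nonneg.2 h), mul_comm ε]
    exact key t s h (by linarith) (by linarith)
  · have := key s t h (by linarith) (by linarith)
    rw [abs_of_nonpos (sub_nonpos.2 h), ← abs_neg]
    convert! this using 1
    · congr 1; ring
    · ring

/-! ### Bounded solutions on the line -/

/-- A planar second order system with bounded continuous right-hand sides which push outwards beyond
`±M` has a solution on the whole line with values in `[-M, M]`. -/
theorem exists_bounded_solution {F G : ℝ → ℝ → ℝ → ℝ}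
    (hF : Continuous fun z : ℝ × ℝ × ℝ => F z.1 z.2.1 z.2.2)
    (hG : Continuous fun z : ℝ × ℝ × ℝ => G z.1 z.2.1 z.2.2) {B M : ℝ} (hM : 0 ≤ M)
    (hFB : ∀ t x y, |F t x y| ≤ B) (hGB : ∀ t x y, |G t x y| ≤ B)
    (hF_pos : ∀ t x y, M < x → 0 < F t x y) (hF_neg : ∀ t x y, x < -M → F t x y < 0)
    (hG_pos : ∀ t x y, M < y → 0 < G t x y) (hG_neg : ∀ t x y, y < -M → G t x y < 0) :
    ∃ u v w e : ℝ → ℝ, (∀ t, |u t| ≤ M) ∧ (∀ t, |v t| ≤ M) ∧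
      (∀ t, HasDerivAt u (w t) t) ∧ (∀ t, HasDerivAt v (e t) t) ∧
      (∀ t, HasDerivAt w (F t (u t) (v t)) t) ∧ (∀ t, HasDerivAt e (G t (u t) (v t)) t) := by
  have hB : 0 ≤ B := (abs_nonneg _).trans (hFB 0 0 0)
  -- `2 * n ^ 2` steps of width `1 / n` lead from `-n` to `n`.
  have hdisc : ∀ n : ℕ, ∃ x y w e : ℕ → ℝ, 0 < n → x 0 = 0 ∧ y 0 = 0 ∧
      x (2 * n ^ 2) = 0 ∧ y (2 * n ^ 2) = 0 ∧
      (∀ k, x (k + 1) = x k + 1 / n * w k) ∧ (∀ k, y (k + 1) = y k + 1 / n * e k) ∧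
      (∀ k, w (k + 1) = w k + 1 / n * F (meshNode (n, k + 1)) (x (k + 1)) (y (k + 1))) ∧
      (∀ k, e (k + 1) = e k + 1 / n * G (meshNode (n, k + 1)) (x (k + 1)) (y (k + 1))) :=
      fun n => by
    obtain rfl | hn := Nat.eq_zero_or_pos n
    · exact ⟨0, 0, 0, 0, fun h => absurd h (lt_irrefl _)⟩
    · obtain ⟨x, y, w, e, h⟩ := exists_discrete_dirichlet
        (F := fun k => F (meshNode (n, k))) (G := fun k => G (meshNode (n, k)))
        (fun k => hF.comp (by fun_prop : Continuous fun z : ℝ × ℝ => (meshNode (n, k), z)))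
        (fun k => hG.comp (by fun_prop : Continuous fun z : ℝ × ℝ => (meshNode (n, k), z)))
        (δ := 1 / n) (by positivity) (fun _ => hFB _) (fun _ => hGB _)
        (N := 2 * n ^ 2) (by positivity)
      exact ⟨x, y, w, e, fun _ => h⟩
  choose x y w e h using hdisc
  have hx := fun n hn => (h n hn).2.2.2.2.1
  have hy := fun n hn => (h n hn).2.2.2.2.2.1
  have hw := fun n hn => (h n hn).2.2.2.2.2.2.1
  have he := fun n hn => (h n hn).2.2.2.2.2.2.2
  have hxM : ∀ n, 0 < n → ∀ k ≤ 2 * n ^ 2, |x n k| ≤ M := fun n hn k hk =>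
    discrete_abs_le (by positivity) hM (hx n hn) (hw n hn) (h n hn).1 (h n hn).2.2.1
      (fun _ => hF_pos _ _ _) (fun _ => hF_neg _ _ _) hk
  have hyM : ∀ n, 0 < n → ∀ k ≤ 2 * n ^ 2, |y n k| ≤ M := fun n hn k hk =>
    discrete_abs_le (by positivity) hM (hy n hn) (he n hn) (h n hn).2.1 (h n hn).2.2.2.1
      (fun _ => hG_pos _ _ _) (fun _ => hG_neg _ _ _) hk
  -- Nodes near a fixed `t` are eventually at least `n` steps from the right end, as the slope bound
  -- requires.
  have hrange : ∀ t, ∀ᶠ p in meshFilter (hyperfilter ℕ) t,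
      0 < p.1 ∧ p.2 + p.1 ≤ 2 * p.1 ^ 2 := fun t => by
    have hfst := tendsto_fst_meshFilter (hyperfilter ℕ) t
    filter_upwards [hfst.eventually eventually_hyperfilter_pos,
      hfst.eventually (eventually_hyperfilter_ge (t + 2)),
      (tendsto_meshNode (hyperfilter ℕ) t).eventually_lt_const (lt_add_one t)] with p hn hnt hp
    have hn' : (0 : ℝ) < p.1 := by exact_mod_cast hn
    refine ⟨hn, ?_⟩
    rw [meshNode, sub_lt_iff_lt_add, div_lt_iff₀ hn'] at hp
    have : (p.2 + p.1 : ℝ) ≤ 2 * p.1 ^ 2 := by nlinarith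
    exact_mod_cast this
  obtain ⟨u, huM, hu⟩ := exists_mesh_limit (Z := x) (D := M) fun t =>
    (hrange t).mono fun p hp => hxM _ hp.1 _ (by omega)
  obtain ⟨v, hvM, hv⟩ := exists_mesh_limit (Z := y) (D := M) fun t =>
    (hrange t).mono fun p hp => hyM _ hp.1 _ (by omega)
  have hwD : ∀ t, ∀ᶠ p in meshFilter (hyperfilter ℕ) t, |w p.1 p.2| ≤ 2 * M + B := fun t =>
    (hrange t).mono fun p hp => discrete_slope_abs_le hp.1 hB (hx _ hp.1) (hw _ hp.1)
      (hxM _ hp.1) (fun _ => hFB _ _ _) hp.2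
  have heD : ∀ t, ∀ᶠ p in meshFilter (hyperfilter ℕ) t, |e p.1 p.2| ≤ 2 * M + B := fun t =>
    (hrange t).mono fun p hp => discrete_slope_abs_le hp.1 hB (hy _ hp.1) (he _ hp.1)
      (hyM _ hp.1) (fun _ => hGB _ _ _) hp.2
  obtain ⟨w', -, hw'⟩ := exists_mesh_limit hwD
  obtain ⟨e', -, he'⟩ := exists_mesh_limit heD
  have hnodes : ∀ t, Tendsto (fun p : ℕ × ℕ => (meshNode p, x p.1 p.2, y p.1 p.2))
      (meshFilter (hyperfilter ℕ) t) (𝓝 (t, u t, v t)) := fun t =>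
    (tendsto_meshNode _ t).prodMk_nhds
      ((tendsto_mesh_of_slope_bounded hx (hwD t) (hu t)).prodMk_nhds
        (tendsto_mesh_of_slope_bounded hy (heD t) (hv t)))
  have hFlim := fun t => (hF.tendsto _).comp ((hnodes t).comp (tendsto_succ_meshFilter t))
  have hGlim := fun t => (hG.tendsto _).comp ((hnodes t).comp (tendsto_succ_meshFilter t))
  exact ⟨u, v, w', e', huM, hvM,
    fun t => hasDerivAt_mesh_limit hx (tendsto_mesh_of_slope_bounded hw
      (.of_forall fun _ => hFB _ _ _) (hw' t)) hu,
    fun t => hasDerivAt_mesh_limit hy (tendsto_mesh_of_slope_bounded he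
      (.of_forall fun _ => hGB _ _ _) (he' t)) hv,
    fun t => hasDerivAt_mesh_limit hw (hFlim t) hw',
    fun t => hasDerivAt_mesh_limit he (hGlim t) he'⟩

/-! ### Truncation -/

/-- Projection of the line onto `[-M, M]`. -/
def clip (M x : ℝ) : ℝ := max (-M) (min M x)

theorem continuous_clip (M : ℝ) : Continuous (clip M) := by unfold clip; fun_prop

theorem clip_mem {M : ℝ} (hM : 0 ≤ M) (x : ℝ) : clip M x ∈ Set.Icc (-M) M :=
  ⟨le_max_left _ _, max_le (by linarith) (min_le_left _ _)⟩

theorem clip_eq_self {M x : ℝ} (h : |x| ≤ M) : clip M x = x := by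
  rw [clip, min_eq_right (abs_le.1 h).2, max_eq_right (abs_le.1 h).1]

theorem clip_of_le {M x : ℝ} (hM : 0 ≤ M) (h : M ≤ x) : clip M x = M := by
  rw [clip, min_eq_left h, max_eq_right (by linarith)]

theorem clip_of_le_neg {M x : ℝ} (h : x ≤ -M) : clip M x = -M :=
  max_eq_left ((min_le_right _ _).trans h)

theorem exists_sign_threshold {a h : ℝ → ℝ} {f : ℝ → ℝ → ℝ} {c : ℝ} (hc : 0 < c)
    (ha : ∀ t, c ≤ a t) (hh : ∃ H : ℝ, ∀ t, |h t| ≤ H)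
    (hf_top : ∀ K : ℝ, ∃ R : ℝ, ∀ x, R ≤ x → ∀ y, K ≤ f x y)
    (hf_bot : ∀ K : ℝ, ∃ R : ℝ, ∀ x, x ≤ R → ∀ y, f x y ≤ K) :
    ∃ R : ℝ, ∀ t x y, (R ≤ x → 0 < a t * f x y + h t) ∧ (x ≤ -R → a t * f x y + h t < 0) := by
  obtain ⟨H, hH⟩ := hh
  have hH0 : 0 ≤ H := (abs_nonneg _).trans (hH 0)
  have hK : 0 ≤ (H + 1) / c := by positivity
  -- The level `(H + 1) / c` makes the `f` term at least `H + 1` in size, which outweighs `h`.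
  have hcK : c * ((H + 1) / c) = H + 1 := mul_div_cancel₀ _ hc.ne'
  obtain ⟨R₁, h₁⟩ := hf_top ((H + 1) / c)
  obtain ⟨R₂, h₂⟩ := hf_bot (-((H + 1) / c))
  refine ⟨max R₁ (-R₂), fun t x y => ⟨fun hx => ?_, fun hx => ?_⟩⟩
  · have h3 := mul_le_mul (ha t) (h₁ x ((le_max_left _ _).trans hx) y) hK (hc.le.trans (ha t))
    linarith [(abs_le.1 (hH t)).1]
  · have h4 := h₂ x (by linarith [le_max_right R₁ (-R₂)]) y
    have h3 := mul_le_mul (ha t) (le_neg_of_le_neg h4) hK (hc.le.trans (ha t))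
    linarith [(abs_le.1 (hH t)).2]

theorem exists_bound_of_clip {a h : ℝ → ℝ} {f : ℝ → ℝ → ℝ} {C : ℝ}
    (hf : Continuous fun p : ℝ × ℝ => f p.1 p.2) (ha : ∀ t, |a t| ≤ C)
    (hh : ∃ H : ℝ, ∀ t, |h t| ≤ H) {M : ℝ} (hM : 0 ≤ M) :
    ∃ B, ∀ t x y, |a t * f (clip M x) (clip M y) + h t| ≤ B := by
  obtain ⟨H, hH⟩ := hh
  obtain ⟨K, hK⟩ := ((isCompact_Icc (a := -M) (b := M)).prod
    (isCompact_Icc (a := -M) (b := M))).exists_bound_of_continuousOn hf.continuousOn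
  refine ⟨C * K + H, fun t x y => (abs_add_le _ _).trans (add_le_add ?_ (hH t))⟩
  rw [abs_mul]
  exact mul_le_mul (ha t) (hK (clip M x, clip M y) ⟨clip_mem hM x, clip_mem hM y⟩)
    (abs_nonneg _) ((abs_nonneg _).trans (ha t))

theorem contDiff_two_of_hasDerivAt {u w φ : ℝ → ℝ} (hu : ∀ t, HasDerivAt u (w t) t)
    (hw : ∀ t, HasDerivAt w (φ t) t) (hφ : Continuous φ) :
    ContDiff ℝ 2 u ∧ deriv (deriv u) = φ := by
  have hdu : deriv u = w := funext fun t => (hu t).deriv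
  have hdw : deriv w = φ := funext fun t => (hw t).deriv
  have hw1 : ContDiff ℝ 1 w :=
    contDiff_one_iff_deriv.2 ⟨fun t => (hw t).differentiableAt, by rwa [hdw]⟩
  refine ⟨?_, by rw [hdu, hdw]⟩
  rw [show (2 : WithTop ℕ∞) = 1 + 1 by norm_num, contDiff_succ_iff_deriv]
  exact ⟨fun t => (hu t).differentiableAt, by simp, by rwa [hdu]⟩

theorem theorem2p2
    (a₁ a₂ h₁ h₂ : ℝ → ℝ) (f g fx fy gx gy : ℝ → ℝ → ℝ) (c C α : ℝ)
    -- the coefficients are continuous and pinched between positive constants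
    (ha₁ : Continuous a₁) (ha₂ : Continuous a₂)
    (hc : 0 < c) (hcC : c ≤ C)
    (ha₁_bd : ∀ t, c ≤ a₁ t ∧ a₁ t ≤ C) (ha₂_bd : ∀ t, c ≤ a₂ t ∧ a₂ t ≤ C)
    -- the right-hand sides are continuous and bounded
    (hh₁ : Continuous h₁) (hh₂ : Continuous h₂)
    (hh₁_bd : ∃ M : ℝ, ∀ t, |h₁ t| ≤ M) (hh₂_bd : ∃ M : ℝ, ∀ t, |h₂ t| ≤ M)
    -- the nonlinearities are jointly continuous and have first partial derivatives everywhere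
    (hf : Continuous fun p : ℝ × ℝ => f p.1 p.2)
    (hg : Continuous fun p : ℝ × ℝ => g p.1 p.2)
    (hfx : ∀ x y, HasDerivAt (fun s => f s y) (fx x y) x)
    (hfy : ∀ x y, HasDerivAt (fun s => f x s) (fy x y) y)
    (hgx : ∀ x y, HasDerivAt (fun s => g s y) (gx x y) x)
    (hgy : ∀ x y, HasDerivAt (fun s => g x s) (gy x y) y)
    -- `f` tends to `±∞` as `x` tends to `±∞`, uniformly in `y`
    (hf_top : ∀ K : ℝ, ∃ R : ℝ, ∀ x, R ≤ x → ∀ y, K ≤ f x y)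
    (hf_bot : ∀ K : ℝ, ∃ R : ℝ, ∀ x, x ≤ R → ∀ y, f x y ≤ K)
    -- `g` tends to `±∞` as `y` tends to `±∞`, uniformly in `x`
    (hg_top : ∀ K : ℝ, ∃ R : ℝ, ∀ y, R ≤ y → ∀ x, K ≤ g x y)
    (hg_bot : ∀ K : ℝ, ∃ R : ℝ, ∀ y, y ≤ R → ∀ x, g x y ≤ K)
    -- lower bounds on `x f` and `y g`
    (hxf : ∀ x y, α ≤ x * f x y) (hyg : ∀ x y, α ≤ y * g x y)
    -- the quadratic form in `(w, z)` is positive semi-definite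
    (hform : ∀ t x y w z : ℝ,
      0 ≤ a₁ t * fx x y * w ^ 2 + (a₁ t * fy x y + a₂ t * gx x y) * (w * z)
        + a₂ t * gy x y * z ^ 2) :
    ∃ u v : ℝ → ℝ,
      ContDiff ℝ 2 u ∧ ContDiff ℝ 2 v ∧
      (∀ t, deriv (deriv u) t - a₁ t * f (u t) (v t) = h₁ t) ∧
      (∀ t, deriv (deriv v) t - a₂ t * g (u t) (v t) = h₂ t) ∧
      ∃ K : ℝ, ∀ t, |u t| ≤ K ∧ |v t| ≤ K := by

  obtain ⟨R₁, hR₁⟩ := exists_sign_threshold hc (fun t => (ha₁_bd t).1) hh₁_bd hf_top hf_bot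
  obtain ⟨R₂, hR₂⟩ := exists_sign_threshold (f := fun y x => g x y) hc
    (fun t => (ha₂_bd t).1) hh₂_bd hg_top hg_bot
  obtain ⟨M, hM, hM₁, hM₂⟩ : ∃ M, 0 ≤ M ∧ R₁ ≤ M ∧ R₂ ≤ M :=
    ⟨max 0 (max R₁ R₂), le_max_left _ _, by simp, by simp⟩
  obtain ⟨B₁, hB₁⟩ := exists_bound_of_clip hf (C := C)
    (fun t => abs_le.2 ⟨by linarith [(ha₁_bd t).1], (ha₁_bd t).2⟩) hh₁_bd hM
  obtain ⟨B₂, hB₂⟩ := exists_bound_of_clip hg (C := C)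
    (fun t => abs_le.2 ⟨by linarith [(ha₂_bd t).1], (ha₂_bd t).2⟩) hh₂_bd hM
  have hclip := continuous_clip M
  have hcont : ∀ {a h : ℝ → ℝ} {k : ℝ → ℝ → ℝ}, Continuous a → Continuous h →
      (Continuous fun p : ℝ × ℝ => k p.1 p.2) →
      Continuous fun z : ℝ × ℝ × ℝ => a z.1 * k (clip M z.2.1) (clip M z.2.2) + h z.1 :=
    fun ha hh hk => by
      have := hk.comp (by fun_prop :
        Continuous fun z : ℝ × ℝ × ℝ => (clip M z.2.1, clip M z.2.2))
      simp only [Function.comp_def] at this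
      fun_prop
  obtain ⟨u, v, w, e, huM, hvM, hu, hv, hw, he⟩ := exists_bounded_solution
    (F := fun t x y => a₁ t * f (clip M x) (clip M y) + h₁ t)
    (G := fun t x y => a₂ t * g (clip M x) (clip M y) + h₂ t) (B := max B₁ B₂)
    (hcont ha₁ hh₁ hf) (hcont ha₂ hh₂ hg) hM
    (fun t x y => (hB₁ t x y).trans (le_max_left _ _))
    (fun t x y => (hB₂ t x y).trans (le_max_right _ _))
    -- Beyond `±M` the clipped coordinate equals `±M`, already past the threshold, whatever the
    -- other coordinate is.
    (fun t x y hx => (hR₁ t _ _).1 (by rwa [clip_of_le hM hx.le]))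
    (fun t x y hx => (hR₁ t _ _).2 (by rw [clip_of_le_neg hx.le]; linarith))
    (fun t x y hy => (hR₂ t _ _).1 (by rwa [clip_of_le hM hy.le]))
    (fun t x y hy => (hR₂ t _ _).2 (by rw [clip_of_le_neg hy.le]; linarith))
  simp only [clip_eq_self (huM _), clip_eq_self (hvM _)] at hw he
  have huc : Continuous u := continuous_iff_continuousAt.2 fun t => (hu t).continuousAt
  have hvc : Continuous v := continuous_iff_continuousAt.2 fun t => (hv t).continuousAt
  have hfuv : Continuous fun t => f (u t) (v t) := hf.comp (huc.prodMk hvc)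
  have hguv : Continuous fun t => g (u t) (v t) := hg.comp (huc.prodMk hvc)
  obtain ⟨hu2, hddu⟩ := contDiff_two_of_hasDerivAt hu hw (by fun_prop)
  obtain ⟨hv2, hddv⟩ := contDiff_two_of_hasDerivAt hv he (by fun_prop)
  exact ⟨u, v, hu2, hv2, fun t => by rw [hddu]; ring, fun t => by rw [hddv]; ring,
    M, fun t => ⟨huM t, hvM t⟩⟩
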